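/- Let $L$ be a countable first-order language and let $T$ be a complete $L$-theory whose set $S(T)=\bigcup_{n}S_n(T)$ of complete types over $\varnothing$ in finitely many variables has cardinality $2^{\omega}$ (the class of such theories is denoted $\mathcal T_c$). All models are nonempty. We use the following notions. - A formula is consistent with a theory $T'$ if it is satisfied by some tuple in some model of $T'$. An *i-formula* of $T'$ is a consistent formula $\varphi(\bar x)$ that belongs to an isolated complete type of $T'$ in the variables $\bar x$. For a finite tuple $\bar b$ of a model $M$, a formula $\varphi(\bar x,\bar b)$ is called consistent, or an i-formula, if it is so for the complete theory of $(M,\bar b)$, where $\bar b$ is named by new constants. - A model $M$ is *prime over a finite tuple* $\bar b\in M$ (equivalently, over the finite set of its entries) if for every structure $N$ and every tuple $\bar c\in N$ with $\operatorname{tp}^N(\bar c)=\operatorname{tp}^M(\bar b)$ there is an elementary embedding $M\to N$ taking $\bar b$ to $\bar c$. - A model $M$ is *limit* if it is not prime over any finite tuple, but $M=\bigcup_{n\in\omega}M_n$ for some elementary chain $M_0\preccurlyeq M_1\preccurlyeq\cdots$ of models each of which is prime over some finite tuple of its elements. - $T$ is *npl-zero* if the set of isomorphism types of countable models of $T$ that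 are neither prime over a finite tuple nor limit has cardinality $0$. Then: 1. A countable model $M$ of $T$ is prime over a finite set or limit if and only if every finite tuple $\bar a\in M$ extends to a finite tuple $\bar b\in M$ such that every consistent formula $\varphi(\bar x,\bar b)$ is an i-formula. 2. $T$ is npl-zero if and only if in every countable model $M$ of $T$ every finite tuple $\bar a\in M$ extends to a finite tuple $\bar b\in M$ such that every consistent formula $\varphi(\bar x,\bar b)$ is an i-formula. -/

import Mathlib

universe u v w

open FirstOrder Cardinal

namespace FirstOrder.Language

section Formulas

variable {L : Language.{u, v}}

/-- The formula `φ(x₀, …, x₍ₙ₋₁₎)` is consistent with `T`: it is satisfied by some tuple in some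
model of `T`. -/
def Theory.IsConsistentFormula (T : L.Theory) {n : ℕ} (φ : L.Formula (Fin n)) : Prop :=
  ∃ (N : Theory.ModelType.{u, v, max u v} T) (c : Fin n → N), φ.Realize c

/-- A complete type is isolated (principal) if it is the only complete type of `T`, in the same
variables, that contains a certain formula. -/
def Theory.CompleteType.IsIsolated {T : L.Theory} {n : ℕ} (p : T.CompleteType (Fin n)) : Prop :=
  ∃ ψ : L.Formula (Fin n), Formula.equivSentence ψ ∈ p ∧
    ∀ q : T.CompleteType (Fin n), Formula.equivSentence ψ ∈ q → q = p

/-- An i-formula of `T`: a consistent formula that belongs to some isolated complete type. -/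
def Theory.IsIFormula (T : L.Theory) {n : ℕ} (φ : L.Formula (Fin n)) : Prop :=
  T.IsConsistentFormula φ ∧
    ∃ p : T.CompleteType (Fin n), p.IsIsolated ∧ Formula.equivSentence φ ∈ p

/-- The class of countable complete theories with continuum many types, where
`S(T) = ⋃ₙ Sₙ(T)` is the set of all complete types of `T` in finitely many variables. -/
structure Theory.IsUnsmall (T : L.Theory) : Prop where
  countable : Countable L.Symbols
  complete : T.IsComplete
  card_types : #(Σ n : ℕ, T.CompleteType (Fin n)) = 𝔠

end Formulas

section Models

variable (L : Language.{u, v}) {M : Type w} [L.Structure M]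

/-- The complete theory of the expansion `(M, b̄)` of `M` by constants naming the entries of the
tuple `b̄`. Formulas `φ(x̄, b̄)` are formulas of its language `L[[Fin m]]`. -/
def tupleTheory {m : ℕ} (b : Fin m → M) : L[[Fin m]].Theory :=
  letI : (constantsOn (Fin m)).Structure M := constantsOn.structure b
  L[[Fin m]].completeTheory M

/-- Every consistent formula `φ(x̄, b̄)` is an i-formula (of the theory of `(M, b̄)`). -/
def AllConsistentAreIFormulas {m : ℕ} (b : Fin m → M) : Prop :=
  ∀ (n : ℕ) (φ : L[[Fin m]].Formula (Fin n)),
    (L.tupleTheory b).IsConsistentFormula φ → (L.tupleTheory b).IsIFormula φ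

/-- `M` is prime over the tuple `b̄`: it embeds elementarily, with `b̄` sent to `c̄`, into every
structure `N` with a tuple `c̄` that has the same complete type as `b̄`. -/
def IsPrimeOver {m : ℕ} (b : Fin m → M) : Prop :=
  ∀ (N : Type w) [L.Structure N] (c : Fin m → N),
    (∀ φ : L.Formula (Fin m), φ.Realize b ↔ φ.Realize c) →
      ∃ f : M ↪ₑ[L] N, ⇑f ∘ b = c

variable (M)

/-- `M` is prime over some finite tuple of its elements, that is, over the finite set of the
entries of such a tuple. -/
def IsPrimeOverFinite : Prop :=
  ∃ (m : ℕ) (b : Fin m → M), L.IsPrimeOver b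

variable {L M} in
/-- An elementary chain `S₀ ≼ S₁ ≼ S₂ ≼ …` of substructures of `M`. -/
structure IsElementaryChain (S : ℕ → L.Substructure M) : Prop where
  le_succ : ∀ n, S n ≤ S (n + 1)
  elementary : ∀ (n k : ℕ) (φ : L.Formula (Fin k)) (x : Fin k → S n),
    φ.Realize (⇑(Substructure.inclusion (le_succ n)) ∘ x) ↔ φ.Realize x

/-- `M` is a limit model: it is not prime over a tuple, and it is the union of an elementary chain
of models each of which is prime over a tuple. -/
def IsLimitModel : Prop :=
  ¬ L.IsPrimeOverFinite M ∧
    ∃ S : ℕ → L.Substructure M, IsElementaryChain S ∧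
      (∀ n, L.IsPrimeOverFinite (S n)) ∧ ∀ x : M, ∃ n, x ∈ S n

/-- Every tuple `ā` of `M` extends to a tuple `b̄ = ā ⌢ c̄` of `M` such that every consistent formula
`φ(x̄, b̄)` is an i-formula. -/
def TuplesExtendToIFormulaTuples : Prop :=
  ∀ (n : ℕ) (a : Fin n → M), ∃ (k : ℕ) (c : Fin k → M),
    L.AllConsistentAreIFormulas (Fin.append a c)

end Models

section Counting

variable {L : Language.{u, v}}

/-- The countable models of `T`. -/
def Theory.CountableModel (T : L.Theory) :=
  { M : Theory.ModelType.{u, v, w} T // Countable M }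

/-- Isomorphism of countable models. -/
def Theory.countableModelSetoid (T : L.Theory) : Setoid (Theory.CountableModel.{u, v, w} T) where
  r M N := Nonempty (M.1 ≃[L] N.1)
  iseqv :=
    ⟨fun M => ⟨Equiv.refl L M.1⟩, fun ⟨e⟩ => ⟨e.symm⟩, fun ⟨e⟩ ⟨f⟩ => ⟨f.comp e⟩⟩

/-- The set **NPL**(T) of isomorphism types of countable models of `T` that are neither prime over
a tuple nor limit. -/
def Theory.nplSet (T : L.Theory) : Set (Quotient (Theory.countableModelSetoid.{u, v, w} T)) :=
  { c | ∃ M : Theory.CountableModel.{u, v, w} T, Quotient.mk _ M = c ∧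
      ¬ L.IsPrimeOverFinite M.1 ∧ ¬ L.IsLimitModel M.1 }

/-- `T` is npl-zero: the number of its countable models that are neither prime over a tuple nor
limit, counted up to isomorphism, is zero. -/
def Theory.IsNplZero (T : L.Theory) : Prop :=
  #(Theory.nplSet.{u, v, w} T) = 0

end Counting

end FirstOrder.Language

/-! Read inside `M`, the i-formula condition on a tuple says that isolated types are dense over its
range (`allConsistentAreIFormulas_iff`); isolation is phrased with definable subsets of powers of
`M`, so no types are mentioned. For the direct implication, a model prime over a tuple is atomic
over it by omitting types (`IsPrimeOver.isIsolatedOver`), and it stays atomic after any finite tuple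
is adjoined to the parameters. In a limit model a finite tuple lies in one member of the chain,
which is an elementary submodel, and density passes up along elementary embeddings. For the
converse, prime models chosen one at a time over larger and larger good sets need not be nested. All
members of the chain are therefore built together from finite approximations (`AtomicChainStage`). A
witness needed by the `i`-th member is chosen with isolated type over the current part of every
member from the `i`-th on, so it may enter all of them without destroying atomicity over their
bases. This is possible because density survives the adjunction of an isolated tuple
(`IsolatedDense.union_range`). A generic sequence of stages gives members that are elementary by
Tarski–Vaught, atomic over a finite base, hence prime over it, and that cover `M`
(`exists_isElementaryChain`). The second claim is the first one quantified over all countable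
models. -/

namespace FirstOrder.Language

open Set

/-! ### Isolated types and their density over a parameter set -/

section Isolated

variable {L : Language.{u, v}} {M : Type w} [L.Structure M] {A B : Set M}
variable {α β : Type*}

variable (L) in
/-- The type of the tuple `d` over the parameter set `A` is isolated. -/
def IsIsolatedOver (A : Set M) (d : α → M) : Prop :=
  ∃ s : Set (α → M), A.Definable L s ∧ d ∈ s ∧ ∀ t, A.Definable L t → d ∈ t → s ⊆ t

variable (L) in
/-- The isolated types over `A` are dense. -/
def IsolatedDense (A : Set M) : Prop :=
  ∀ (n : ℕ) (s : Set (Fin n → M)), A.Definable L s → s.Nonempty → ∃ d ∈ s, L.IsIsolatedOver A d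

/-- An isolating set lies inside or outside each `A`-definable set, so each of its points is
isolated by it. -/
theorem subset_of_isolates {s t : Set (α → M)} {d e : α → M}
    (h : ∀ t, A.Definable L t → d ∈ t → s ⊆ t) (he : e ∈ s) (ht : A.Definable L t) (het : e ∈ t) :
    s ⊆ t := by
  by_cases hd : d ∈ t
  · exact h t ht hd
  · exact absurd het (h _ ht.compl hd he)

/-- The extra parameters `d` become coordinates: a set definable over `B ∪ range d` is a fibre at
`d` of a `B`-definable set. -/
theorem definable_union_range_iff {d : α → M} {t : Set (β → M)} :
    (B ∪ range d).Definable L t ↔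
      ∃ t' : Set (α ⊕ β → M), B.Definable L t' ∧ t = {e | Sum.elim d e ∈ t'} := by
  simp only [definable_iff_exists_formula_sum]
  constructor
  · rintro ⟨φ, rfl⟩
    have hg : ∀ c : ↥(B ∪ range d), ∃ x : B ⊕ α, Sum.elim (↑) d x = (c : M) := by
      rintro ⟨c, hc | ⟨a, rfl⟩⟩
      · exact ⟨Sum.inl ⟨c, hc⟩, rfl⟩
      · exact ⟨Sum.inr a, rfl⟩
    choose g hg using hg
    refine ⟨_, ⟨φ.relabel (_root_.Equiv.sumAssoc B α β ∘ Sum.map g id), rfl⟩, ?_⟩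
    ext e
    simp only [mem_ofPred_eq, Formula.realize_relabel]
    refine iff_of_eq (congrArg _ (funext ?_))
    rintro (c | c)
    · rw [Sum.elim_inl, ← hg c]
      rcases hgc : g c with x | x <;> simp [hgc]
    · simp
  · rintro ⟨_, ⟨φ, rfl⟩, rfl⟩
    refine ⟨φ.relabel (Sum.elim (fun c : B => Sum.inl ⟨c, Or.inl c.2⟩)
      (Sum.elim (fun a => Sum.inl ⟨d a, Or.inr ⟨a, rfl⟩⟩) Sum.inr)), ?_⟩
    ext e
    simp only [mem_ofPred_eq, Formula.realize_relabel]
    refine iff_of_eq (congrArg _ (funext ?_))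
    rintro (c | c | c) <;> rfl

theorem definable_range_iff {d : α → M} {t : Set (β → M)} :
    (range d).Definable L t ↔ ∃ φ : L.Formula (α ⊕ β), t = {e | φ.Realize (Sum.elim d e)} := by
  rw [← empty_union (range d), definable_union_range_iff]
  simp only [empty_definable_iff]
  constructor
  · rintro ⟨_, ⟨φ, rfl⟩, rfl⟩
    exact ⟨φ, rfl⟩
  · rintro ⟨φ, rfl⟩
    exact ⟨_, ⟨φ, rfl⟩, rfl⟩

theorem isIsolatedOver_range_iff {b : α → M} {d : β → M} :
    L.IsIsolatedOver (range b) d ↔ ∃ φ : L.Formula (α ⊕ β), φ.Realize (Sum.elim b d) ∧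
      ∀ χ : L.Formula (α ⊕ β), χ.Realize (Sum.elim b d) →
        ∀ e, φ.Realize (Sum.elim b e) → χ.Realize (Sum.elim b e) := by
  simp only [IsIsolatedOver, definable_range_iff]
  constructor
  · rintro ⟨_, ⟨φ, rfl⟩, hd, h⟩
    exact ⟨φ, hd, fun χ hχ e he => h _ ⟨χ, rfl⟩ hχ he⟩
  · rintro ⟨φ, hd, h⟩
    refine ⟨_, ⟨φ, rfl⟩, hd, ?_⟩
    rintro _ ⟨χ, rfl⟩ hχ e he
    exact h χ hχ e he

theorem IsIsolatedOver.comp [Finite α] [Finite β] {d : α → M} (h : L.IsIsolatedOver A d)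
    (f : β → α) : L.IsIsolatedOver A (d ∘ f) := by
  obtain ⟨s, hs, hd, h⟩ := h
  refine ⟨_, hs.image_comp f, ⟨d, hd, rfl⟩, fun t ht hdt => ?_⟩
  rintro _ ⟨e, he, rfl⟩
  exact h _ (ht.preimage_comp f) hdt he

theorem IsolatedDense.exists_isIsolatedOver [Finite α] (h : L.IsolatedDense A) {s : Set (α → M)}
    (hs : A.Definable L s) (hne : s.Nonempty) : ∃ d ∈ s, L.IsIsolatedOver A d := by
  obtain ⟨n, ⟨e⟩⟩ := Finite.exists_equiv_fin α
  obtain ⟨d₀, hd₀⟩ := hne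
  obtain ⟨d, hd, hi⟩ := h n _ (hs.preimage_comp e) ⟨d₀ ∘ e.symm, by
    simpa [Function.comp_assoc] using hd₀⟩
  exact ⟨d ∘ e, hd, hi.comp e⟩

theorem IsIsolatedOver.sumElim {d : α → M} {e : β → M} (hd : L.IsIsolatedOver B d)
    (he : L.IsIsolatedOver (B ∪ range d) e) [Finite β] : L.IsIsolatedOver B (Sum.elim d e) := by
  obtain ⟨s, hs, hds, hs'⟩ := hd
  obtain ⟨t, ht, het, ht'⟩ := he
  obtain ⟨t, htB, rfl⟩ := definable_union_range_iff.1 ht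
  refine ⟨_, (hs.preimage_comp Sum.inl).inter htB, ⟨hds, het⟩, fun r hr her x hx => ?_⟩
  -- That the fibre of `t` is contained in the fibre of `r` is a `B`-definable property of the base
  -- point; it holds at `d`, hence on all of `s`.
  have hall : B.Definable L {y : α → M | ∀ z : β → M, Sum.elim y z ∈ tᶜ ∪ r} :=
    (htB.compl.union hr).forall_of_finite
  have := hs' _ hall (fun z => by
    by_cases hz : Sum.elim d z ∈ t
    · exact Or.inr (ht' _ (definable_union_range_iff.2 ⟨r, hr, rfl⟩) her hz)
    · exact Or.inl hz) hx.1 (x ∘ Sum.inr)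
  rw [Sum.elim_comp_inl_inr] at this
  exact this.resolve_left fun h => h hx.2

theorem IsIsolatedOver.of_sumElim {d : α → M} {e : β → M}
    (h : L.IsIsolatedOver B (Sum.elim d e)) : L.IsIsolatedOver (B ∪ range d) e := by
  obtain ⟨s, hs, hes, hs'⟩ := h
  refine ⟨_, definable_union_range_iff.2 ⟨s, hs, rfl⟩, hes, fun t ht het => ?_⟩
  obtain ⟨t, htB, rfl⟩ := definable_union_range_iff.1 ht
  exact fun x hx => hs' _ htB het hx

/-- Density over `B` gives an isolated joint tuple whose first half lies in the set isolating `d`.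
That half has the type of `d` over `B`, so the second half can be moved over `d` itself. -/
theorem IsolatedDense.union_range [Finite α] {d : α → M} (hB : L.IsolatedDense B)
    (hd : L.IsIsolatedOver B d) : L.IsolatedDense (B ∪ range d) := by
  intro n s hs hne
  obtain ⟨t, htB, rfl⟩ := definable_union_range_iff.1 hs
  obtain ⟨e, he⟩ := hne
  obtain ⟨p, hp, hdp, hp'⟩ := hd
  obtain ⟨x, ⟨hxp, hxt⟩, r, hr, hxr, hr'⟩ := hB.exists_isIsolatedOver
    ((hp.preimage_comp Sum.inl).inter htB) ⟨Sum.elim d e, hdp, he⟩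
  have hex : B.Definable L {y : α → M | ∃ z : Fin n → M, Sum.elim y z ∈ r ∩ t} :=
    (hr.inter htB).exists_of_finite
  obtain ⟨z, hzr, hzt⟩ := subset_of_isolates hp' hxp hex
    ⟨x ∘ Sum.inr, by rw [Sum.elim_comp_inl_inr]; exact ⟨hxr, hxt⟩⟩ hdp
  refine ⟨z, hzt, IsIsolatedOver.of_sumElim ⟨r, hr, hzr, fun t ht hzt =>
    subset_of_isolates hr' hzr ht hzt⟩⟩

theorem definable_singleton_of_forall_mem [Finite α] {d : α → M} (hd : ∀ i, d i ∈ A) :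
    A.Definable L {d} := by
  have : ({d} : Set (α → M)) = ⋂ i, (fun g : α → M => g ∘ fun _ : Fin 1 => i) ⁻¹'
      {x : Fin 1 → M | x 0 ∈ ({d i} : Set M)} := by
    ext x
    simp [funext_iff]
  rw [this]
  exact definable_iInter_of_finite fun i =>
    (Definable.singleton_of_mem L (hd i)).preimage_comp _

theorem isIsolatedOver_of_forall_mem [Finite α] {d : α → M} (hd : ∀ i, d i ∈ A) :
    L.IsIsolatedOver A d :=
  ⟨{d}, definable_singleton_of_forall_mem hd, rfl, fun _ _ hdt => singleton_subset_iff.2 hdt⟩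

end Isolated

/-! ### Countable atomic models are prime -/

section Prime

variable {L : Language.{u, v}} {M N : Type w} [L.Structure M] [L.Structure N]

theorem exists_seq_of_forall_snoc {N : Type*} {P : ∀ n, (Fin n → N) → Prop}
    (h0 : P 0 Fin.elim0) (hs : ∀ n g, P n g → ∃ y, P (n + 1) (Fin.snoc g y)) :
    ∃ g : ℕ → N, ∀ n, P n fun i => g i := by
  choose y hy using hs
  let G : ∀ n, {g : Fin n → N // P n g} := fun n =>
    Nat.rec ⟨Fin.elim0, h0⟩ (fun n g => ⟨Fin.snoc g.1 (y n g.1 g.2), hy n g.1 g.2⟩) n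
  have hG : ∀ n (i : Fin n), (G n).1 i = (G (i + 1)).1 (Fin.last i) := by
    intro n
    induction n with
    | zero => exact fun i => i.elim0
    | succ n ih =>
      intro i
      induction i using Fin.lastCases with
      | last => rfl
      | cast i =>
        have : (G (n + 1)).1 i.castSucc = (G n).1 i :=
          Fin.snoc_castSucc (α := fun _ => N) _ _ _
        rw [this, ih i]
        rfl
  refine ⟨fun n => (G (n + 1)).1 (Fin.last n), fun n => ?_⟩
  have : (fun i : Fin n => (G (i + 1)).1 (Fin.last i)) = (G n).1 :=
    funext fun i => (hG n i).symm
  rw [this]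
  exact (G n).2

/-- The forth step. The existence of a realization of the isolating formula `ψ` is part of the type
of `(b, d)`, and each implication from `ψ` to a formula of the type is part of the type of `b`
alone; both transfer to `N`. -/
theorem exists_snoc_sameType {m n : ℕ} {b : Fin m → M} {c : Fin m → N} {d : Fin n → M}
    {g : Fin n → N} (x : M)
    (hdg : ∀ φ : L.Formula (Fin m ⊕ Fin n), φ.Realize (Sum.elim b d) ↔ φ.Realize (Sum.elim c g))
    (hi : L.IsIsolatedOver (range b) (Fin.snoc d x : Fin (n + 1) → M)) :
    ∃ y : N, ∀ φ : L.Formula (Fin m ⊕ Fin (n + 1)),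
      φ.Realize (Sum.elim b (Fin.snoc d x : Fin (n + 1) → M)) ↔
        φ.Realize (Sum.elim c (Fin.snoc g y : Fin (n + 1) → N)) := by
  obtain ⟨ψ, hψ, hψ'⟩ := isIsolatedOver_range_iff.1 hi
  let r : Fin m ⊕ Fin (n + 1) → (Fin m ⊕ Fin n) ⊕ Fin 1 :=
    Sum.elim (Sum.inl ∘ Sum.inl) (Fin.snoc (Sum.inl ∘ Sum.inr) (Sum.inr 0))
  have hr : ∀ {K : Type w} (p : Fin m → K) (q : Fin n → K) (z : Fin 1 → K),
      Sum.elim (Sum.elim p q) z ∘ r = Sum.elim p (Fin.snoc q (z 0) : Fin (n + 1) → K) := by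
    intro K p q z
    funext i
    rcases i with i | i
    · rfl
    · induction i using Fin.lastCases <;> simp [r]
  obtain ⟨z, hz⟩ := Formula.realize_iExs.1 ((hdg ((ψ.relabel r).iExs (Fin 1))).1
    (Formula.realize_iExs.2 ⟨fun _ => x, by
      rw [Formula.realize_relabel, hr]; exact hψ⟩))
  rw [Formula.realize_relabel, hr] at hz
  have key : ∀ χ : L.Formula (Fin m ⊕ Fin (n + 1)),
      χ.Realize (Sum.elim b (Fin.snoc d x : Fin (n + 1) → M)) →
        χ.Realize (Sum.elim c (Fin.snoc g (z 0) : Fin (n + 1) → N)) := by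
    intro χ hχ
    have h1 : ((ψ.imp χ).iAlls (Fin (n + 1))).Realize b :=
      Formula.realize_iAlls.2 fun e => Formula.realize_imp.2 (hψ' χ hχ e)
    have h2 : ((ψ.imp χ).iAlls (Fin (n + 1))).Realize c := by
      have := (hdg (((ψ.imp χ).iAlls (Fin (n + 1))).relabel Sum.inl)).1 (by
        rw [Formula.realize_relabel]; exact h1)
      rwa [Formula.realize_relabel] at this
    exact Formula.realize_imp.1 (Formula.realize_iAlls.1 h2 _) hz
  refine ⟨z 0, fun φ => ⟨key φ, fun h => ?_⟩⟩
  by_contra hn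
  exact key φ.not hn h

/-- A countable model that is atomic over a tuple is prime over it. -/
theorem isPrimeOver_of_forall_isIsolatedOver [Countable M] [Nonempty M] {m : ℕ} {b : Fin m → M}
    (h : ∀ n (d : Fin n → M), L.IsIsolatedOver (range b) d) : L.IsPrimeOver b := by
  intro N _ c hbc
  obtain ⟨e, he⟩ := exists_surjective_nat M
  obtain ⟨g, hg⟩ := exists_seq_of_forall_snoc (N := N)
    (P := fun n g => ∀ φ : L.Formula (Fin m ⊕ Fin n),
      φ.Realize (Sum.elim b fun i => e i) ↔ φ.Realize (Sum.elim c g))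
    (by
      intro φ
      have hK : ∀ {K : Type w} (p : Fin m → K) (q : Fin 0 → K),
          Sum.elim p q = p ∘ Sum.elim id Fin.elim0 := by
        intro K p q
        funext i
        rcases i with i | i
        · rfl
        · exact i.elim0
      rw [hK, hK, ← Formula.realize_relabel, ← Formula.realize_relabel]
      exact hbc _)
    (fun n g hg => by
      obtain ⟨y, hy⟩ := exists_snoc_sameType (e n) hg (h _ _)
      refine ⟨y, fun φ => ?_⟩
      rw [← hy φ]
      refine iff_of_eq (congrArg _ (congrArg _ (funext fun i => ?_)))
      induction i using Fin.lastCases <;> simp)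
  -- The enumeration `e` may repeat elements, so the embedding reads `g` at one chosen index for
  -- each element.
  obtain ⟨ρ, hρ⟩ := he.hasRightInverse
  have hτ : ∀ {k : ℕ} (τ : Fin k → ℕ) (φ : L.Formula (Fin m ⊕ Fin k)),
      φ.Realize (Sum.elim b (e ∘ τ)) ↔ φ.Realize (Sum.elim c (g ∘ τ)) := by
    intro k τ φ
    obtain ⟨n, hn⟩ : ∃ n, ∀ i, τ i < n :=
      ⟨Finset.univ.sup τ + 1, fun i => Nat.lt_succ_of_le (Finset.le_sup (Finset.mem_univ i))⟩
    have := hg n (φ.relabel (Sum.map id fun i => ⟨τ i, hn i⟩))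
    rw [Formula.realize_relabel, Formula.realize_relabel, Sum.elim_comp_map,
      Sum.elim_comp_map] at this
    exact this
  refine ⟨⟨g ∘ ρ, fun n φ x => ?_⟩, funext fun i => ?_⟩
  · have := hτ (ρ ∘ x) (φ.relabel Sum.inr)
    rw [Formula.realize_relabel, Formula.realize_relabel, Sum.elim_comp_inr,
      Sum.elim_comp_inr, ← Function.comp_assoc e, hρ.comp_eq_id] at this
    exact this.symm
  · have := hτ (fun _ : Fin 1 => ρ (b i)) (Term.equal (Term.var (Sum.inl i)) (Term.var (Sum.inr 0)))
    simp only [Formula.realize_equal, Term.realize_var, Sum.elim_inl, Sum.elim_inr,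
      Function.comp_apply, hρ (b i), true_iff] at this
    exact this.symm

end Prime

/-! ### Omitting types by a generic sequence in an ultrapower -/

section Omitting

variable {L : Language.{u, v}} {M : Type w} [L.Structure M] {A : Set M} {α : Type*}

/-- The Rasiowa–Sikorski lemma, used both for omitting types and for building the chain. -/
theorem exists_generic_seq {P ι : Type*} [Preorder P] [Countable ι] (D : ι → P → Prop)
    (hD : ∀ i x, ∃ y, x ≤ y ∧ D i y) (x₀ : P) :
    ∃ f : ℕ → P, Monotone f ∧ f 0 = x₀ ∧ ∀ i, ∃ n, D i (f n) := by
  have := Encodable.ofCountable ι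
  let 𝒟 : ι → Order.Cofinal P := fun i => ⟨{y | D i y}, fun x => (hD i x).imp fun y h => h.symm⟩
  exact ⟨Order.sequenceOfCofinals x₀ 𝒟, Order.sequenceOfCofinals.monotone x₀ 𝒟, rfl,
    fun i => ⟨_, Order.sequenceOfCofinals.encode_mem x₀ 𝒟 i⟩⟩

theorem _root_.Set.Definable.exists_finset {X : Set (α → M)} (hX : A.Definable L X) :
    ∃ (F : Finset α) (Y : Set (F → M)), A.Definable L Y ∧ X = {w | w ∘ (↑) ∈ Y} := by
  classical
  obtain ⟨φ, rfl⟩ := hX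
  refine ⟨φ.freeVarFinset, {v | Formula.Realize (φ.restrictFreeVar id) v},
    ⟨φ.restrictFreeVar id, rfl⟩, ?_⟩
  ext w
  exact (BoundedFormula.realize_restrictFreeVar (L := L[[A]]) (φ := φ) (f := id)
    (v := fun a : φ.freeVarFinset => w a) (xs := default) w fun _ => rfl).symm

theorem _root_.Set.Definable.exists_support {X : Set (α → M)} (hX : A.Definable L X) :
    ∃ F : Finset α, ∀ w w' : α → M, (∀ i ∈ F, w i = w' i) → w ∈ X → w' ∈ X := by
  obtain ⟨F, Y, _, rfl⟩ := hX.exists_finset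
  refine ⟨F, fun w w' h hw => ?_⟩
  have : w ∘ ((↑) : F → α) = w' ∘ (↑) := funext fun i => h i i.2
  simpa [← this] using hw

/-- Definability is closed under projections to finitely many coordinates. -/
theorem _root_.Set.Definable.image_comp_of_finite [Nonempty M] {β : Type*} [Finite β]
    {X : Set (α → M)} (hX : A.Definable L X) (f : β → α) :
    A.Definable L ((fun w : α → M => w ∘ f) '' X) := by
  classical
  obtain ⟨F, Y, hY, rfl⟩ := hX.exists_finset
  have := Fintype.ofFinite β
  let G : Finset α := F ∪ Finset.univ.image f
  let i : F → G := fun a => ⟨a, Finset.mem_union_left _ a.2⟩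
  let g : β → G := fun j =>
    ⟨f j, Finset.mem_union_right _ (Finset.mem_image_of_mem f (Finset.mem_univ j))⟩
  refine (congr rfl (ext fun x => ?_)).mp ((hY.preimage_comp i).image_comp g)
  constructor
  · rintro ⟨y, hy, rfl⟩
    let w : α → M := fun a => if h : a ∈ G then y ⟨a, h⟩ else Classical.arbitrary M
    have hw : w ∘ ((↑) : F → α) = y ∘ i := funext fun j => dif_pos (i j).2
    refine ⟨w, ?_, funext fun j => dif_pos (g j).2⟩
    rw [mem_ofPred_eq, hw]
    exact hy
  · rintro ⟨w, hw, rfl⟩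
    exact ⟨fun a => w a, hw, rfl⟩

/-- Both `X` and `φ` depend on finitely many coordinates, so the value at a fresh coordinate can be
reset to the witness. -/
theorem exists_witness_condition (φ : L.Formula (ℕ ⊕ Fin 1)) {X : Set (ℕ → M)}
    (hX : A.Definable L X) {w : ℕ → M} (hw : w ∈ X) {x : M}
    (hx : φ.Realize (Sum.elim w fun _ => x)) :
    ∃ i, ∃ w ∈ X, φ.Realize (Sum.elim w fun _ => w i) := by
  classical
  obtain ⟨F, hF⟩ := hX.exists_support
  have hφ : (∅ : Set M).Definable L {v : ℕ ⊕ Fin 1 → M | φ.Realize v} :=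
    empty_definable_iff.2 ⟨φ, rfl⟩
  obtain ⟨G, hG⟩ := hφ.exists_support
  obtain ⟨i, hi⟩ := Infinite.exists_notMem_finset (F ∪ G.toLeft)
  rw [Finset.mem_union, not_or, Finset.mem_toLeft] at hi
  refine ⟨i, Function.update w i x, hF w _ (fun j hj => ?_) hw, hG _ _ ?_ hx⟩
  · rw [Function.update_of_ne]
    rintro rfl
    exact hi.1 hj
  · rintro (j | j) hj
    · rw [Sum.elim_inl, Sum.elim_inl, Function.update_of_ne]
      rintro rfl
      exact hi.2 hj
    · simp

variable [Nonempty M] {m n : ℕ} {b : Fin m → M} {d : Fin n → M}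

/-- Otherwise the projection of `X` along `σ` would lie in every definable set containing `d`. It
would also contain `d`, since its complement cannot contain it, and so it would isolate `d`. -/
theorem exists_omitting_condition (hd : ¬ L.IsIsolatedOver (range b) d) (σ : Fin n → ℕ)
    {X : Set (ℕ → M)} (hX : (range b).Definable L X) (hne : X.Nonempty) :
    ∃ χ : L.Formula (Fin m ⊕ Fin n), χ.Realize (Sum.elim b d) ∧
      ∃ w ∈ X, ¬ χ.Realize (Sum.elim b (w ∘ σ)) := by
  by_contra! h
  have hZ := hX.image_comp_of_finite σ
  have key : ∀ t, (range b).Definable L t → d ∈ t → (fun w : ℕ → M => w ∘ σ) '' X ⊆ t := by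
    intro t ht hdt
    obtain ⟨χ, rfl⟩ := definable_range_iff.1 ht
    rintro _ ⟨w, hw, rfl⟩
    exact h χ hdt w hw
  refine hd ⟨_, hZ, ?_, key⟩
  by_contra hdZ
  obtain ⟨w, hw⟩ := hne
  exact key _ hZ.compl hdZ ⟨w, hw, rfl⟩ ⟨w, hw, rfl⟩

/-- A sequence of assignments that is generic for the conditions definable over `b`. -/
theorem exists_generic_assignments [Countable L.Symbols] (hd : ¬ L.IsIsolatedOver (range b) d) :
    ∃ w : ℕ → ℕ → M, (∀ j (i : Fin m), w j i = b i) ∧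
      (∀ φ : L.Formula (ℕ ⊕ Fin 1),
        (∀ᶠ j in Filter.atTop, ∀ x, ¬ φ.Realize (Sum.elim (w j) fun _ => x)) ∨
          ∃ i, ∀ᶠ j in Filter.atTop, φ.Realize (Sum.elim (w j) fun _ => w j i)) ∧
      ∀ σ : Fin n → ℕ, ∃ χ : L.Formula (Fin m ⊕ Fin n), χ.Realize (Sum.elim b d) ∧
        ∀ᶠ j in Filter.atTop, ¬ χ.Realize (Sum.elim b (w j ∘ σ)) := by
  -- The order is reversed because a smaller set of assignments is a stronger condition.
  let P := {X : Set (ℕ → M) // (range b).Definable L X ∧ X.Nonempty}ᵒᵈ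
  let sols : P → Set (ℕ → M) := fun X => (OrderDual.ofDual X).1
  let D : L.Formula (ℕ ⊕ Fin 1) ⊕ (Fin n → ℕ) → P → Prop := Sum.elim
    (fun φ X => (∀ w ∈ sols X, ∀ x, ¬ φ.Realize (Sum.elim w fun _ => x)) ∨
      ∃ i, ∀ w ∈ sols X, φ.Realize (Sum.elim w fun _ => w i))
    (fun σ X => ∃ χ : L.Formula (Fin m ⊕ Fin n), χ.Realize (Sum.elim b d) ∧
      ∀ w ∈ sols X, ¬ χ.Realize (Sum.elim b (w ∘ σ)))
  have hD : ∀ i X, ∃ Y, X ≤ Y ∧ D i Y := by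
    rintro (φ | σ) ⟨X, hX, hne⟩
    · by_cases h : ∀ w ∈ X, ∀ x, ¬ φ.Realize (Sum.elim w fun _ => x)
      · exact ⟨⟨X, hX, hne⟩, le_rfl, Or.inl h⟩
      · push Not at h
        obtain ⟨w, hw, x, hx⟩ := h
        obtain ⟨i, w, hw, hi⟩ := exists_witness_condition φ hX hw hx
        have hdef : (range b).Definable L {w : ℕ → M | φ.Realize (Sum.elim w fun _ => w i)} := by
          refine (empty_definable_iff.2 ⟨φ.relabel (Sum.elim id fun _ => i), ?_⟩).mono
            (empty_subset _)
          ext w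
          simp only [mem_ofPred_eq, Formula.realize_relabel]
          refine iff_of_eq (congrArg _ (funext ?_))
          rintro (j | j) <;> rfl
        exact ⟨⟨_, hX.inter hdef, w, hw, hi⟩, inter_subset_left, Or.inr ⟨i, fun w hw => hw.2⟩⟩
    · obtain ⟨χ, hχ, w, hw, hwχ⟩ := exists_omitting_condition hd σ hX hne
      have hdef : (range b).Definable L {e : Fin n → M | χ.Realize (Sum.elim b e)} :=
        definable_range_iff.2 ⟨χ, rfl⟩
      exact ⟨⟨_, hX.inter (hdef.compl.preimage_comp σ), w, hw, hwχ⟩, inter_subset_left,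
        χ, hχ, fun w hw => hw.2⟩
  have h0 : (range b).Definable L {w : ℕ → M | (fun i : Fin m => w i) = b} :=
    (definable_singleton_of_forall_mem (d := b) mem_range_self).preimage_comp Fin.val
  obtain ⟨f, hf, hf0, hfD⟩ := exists_generic_seq D hD (OrderDual.toDual ⟨_, h0,
    fun i => if h : i < m then b ⟨i, h⟩ else Classical.arbitrary M,
    funext fun i => dif_pos i.2⟩)
  choose w hw using fun j => (OrderDual.ofDual (f j)).2.2
  have hwm : ∀ {p j}, p ≤ j → w j ∈ sols (f p) := fun {p j} h => hf h (hw j)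
  refine ⟨w, fun j i => ?_, fun φ => ?_, fun σ => ?_⟩
  · have := hwm (Nat.zero_le j)
    rw [hf0] at this
    exact congrFun this i
  · obtain ⟨p, h | ⟨i, h⟩⟩ := hfD (Sum.inl φ)
    · exact Or.inl (Filter.eventually_atTop.2 ⟨p, fun j hj => h _ (hwm hj)⟩)
    · exact Or.inr ⟨i, Filter.eventually_atTop.2 ⟨p, fun j hj => h _ (hwm hj)⟩⟩
  · obtain ⟨p, χ, hχ, h⟩ := hfD (Sum.inr σ)
    exact ⟨χ, hχ, Filter.eventually_atTop.2 ⟨p, fun j hj => h _ (hwm hj)⟩⟩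

/-- **Omitting types theorem**: a non-isolated type over a tuple is omitted in some structure. -/
theorem exists_structure_omitting [Countable L.Symbols]
    (hd : ¬ L.IsIsolatedOver (range b) d) :
    ∃ (N : Type w) (_ : L.Structure N) (c : Fin m → N),
      (∀ φ : L.Formula (Fin m), φ.Realize b ↔ φ.Realize c) ∧
      ∀ e : Fin n → N, ∃ χ : L.Formula (Fin m ⊕ Fin n),
        χ.Realize (Sum.elim b d) ∧ ¬ χ.Realize (Sum.elim c e) := by
  obtain ⟨w, hwb, hwφ, hwσ⟩ := exists_generic_assignments hd
  let U : Ultrafilter ℕ := Filter.hyperfilter ℕ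
  have hU : ∀ {p : ℕ → Prop}, (∀ᶠ j in Filter.atTop, p j) → ∀ᶠ j in (U : Filter ℕ), p j :=
    fun h => Nat.hyperfilter_le_atTop h
  -- Transposing the generic assignments gives the Henkin constants: the class of `V i` interprets
  -- the `i`-th variable in the ultrapower, and what holds eventually along `w` holds of these
  -- classes.
  let V : ℕ → (_ : ℕ) → M := fun i j => w j i
  let mk : ((_ : ℕ) → M) → (U : Filter ℕ).Product fun _ => M := fun x => x
  have hmk : Function.Surjective mk := Quotient.mk_surjective
  have los : ∀ {β : Type} (φ : L.Formula β) (x : β → (_ : ℕ) → M),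
      φ.Realize (mk ∘ x) ↔ ∀ᶠ j in (U : Filter ℕ), φ.Realize fun i => x i j :=
    fun φ x => Ultraproduct.realize_formula_cast φ x
  have hS : L.MeetsDefinable (range (mk ∘ V)) := by
    rintro E ⟨y, hy⟩ hE
    obtain ⟨φ, hφ⟩ := definable_range_iff.1 hE
    have hφ' : ∀ z, z ∈ E ↔ φ.Realize (Sum.elim (mk ∘ V) fun _ => z) := fun z => by
      have := Set.ext_iff.1 hφ fun _ => z
      exact this
    obtain ⟨y, rfl⟩ := hmk y
    have hel : ∀ z : ℕ → M, φ.Realize (Sum.elim (mk ∘ V) fun _ => mk z) ↔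
        ∀ᶠ j in (U : Filter ℕ), φ.Realize (Sum.elim (w j) fun _ => z j) := by
      intro z
      have h1 : (Sum.elim (mk ∘ V) fun _ : Fin 1 => mk z) = mk ∘ Sum.elim V fun _ => z :=
        (Sum.comp_elim mk V fun _ => z).symm
      have h2 : ∀ j, (fun i => Sum.elim V (fun _ : Fin 1 => z) i j) =
          Sum.elim (w j) fun _ => z j := by
        intro j
        funext i
        rcases i with i | i <;> rfl
      rw [h1, los]
      simp only [h2]
    rw [hφ', hel] at hy
    rcases hwφ φ with h | ⟨i, h⟩
    · obtain ⟨j, hj, hj'⟩ := (hy.and (hU h)).exists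
      exact absurd hj (hj' _)
    · refine ⟨mk (V i), (hφ' _).2 ?_, i, rfl⟩
      exact (hel _).2 (hU h)
  let N := hS.toElementarySubstructure
  have hN : ∀ x : N, ∃ i, mk (V i) = x := by
    rintro ⟨x, hx⟩
    have : x ∈ Substructure.closure L (range (mk ∘ V)) := hx
    rw [← SetLike.mem_coe, hS.closure_eq_self] at this
    exact this
  have hmem : ∀ i, mk (V i) ∈ N := fun i => Substructure.subset_closure ⟨i, rfl⟩
  refine ⟨N, inferInstance, fun i => ⟨mk (V i), hmem i⟩, fun φ => ?_, fun e => ?_⟩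
  · rw [← N.subtype.map_formula]
    refine Iff.trans ?_ (los φ fun i : Fin m => V i).symm
    simp only [V, hwb, Filter.eventually_const]
  · choose σ hσ using fun i => hN (e i)
    obtain ⟨χ, hχ, h⟩ := hwσ σ
    refine ⟨χ, hχ, fun hce => ?_⟩
    rw [← N.subtype.map_formula] at hce
    have heq : (N.subtype ∘ Sum.elim (fun i : Fin m => (⟨mk (V i), hmem i⟩ : N)) e) =
        mk ∘ Sum.elim (fun i : Fin m => V i) (V ∘ σ) := by
      funext i
      rcases i with i | i
      · rfl
      · exact (hσ i).symm
    rw [heq, los] at hce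
    obtain ⟨j, hj, hj'⟩ := (hce.and (hU h)).exists
    refine hj' (Eq.mp (congrArg _ (funext fun i => ?_)) hj)
    rcases i with i | i
    · exact hwb j i
    · rfl

/-- A model that is prime over a tuple is atomic over it. -/
theorem IsPrimeOver.isIsolatedOver [Countable L.Symbols] (hb : L.IsPrimeOver b) (d : Fin n → M) :
    L.IsIsolatedOver (range b) d := by
  by_contra hd
  obtain ⟨N, _, c, hbc, hN⟩ := exists_structure_omitting hd
  obtain ⟨f, hf⟩ := hb N c hbc
  obtain ⟨χ, hχ, h⟩ := hN (f ∘ d)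
  rw [← hf, ← Sum.comp_elim, f.map_formula] at h
  exact h hχ

end Omitting

/-! ### Translating i-formulas into density of isolated types -/

section CompleteTheory

variable {L : Language.{u, v}} {M : Type w} [L.Structure M]

theorem empty_definable_constantsOn_iff {m : ℕ} {b : Fin m → M} {α : Type*} {s : Set (α → M)} :
    letI : (constantsOn (Fin m)).Structure M := constantsOn.structure b
    (∅ : Set M).Definable L[[Fin m]] s ↔ (range b).Definable L s := by
  let _ : (constantsOn (Fin m)).Structure M := constantsOn.structure b
  rw [empty_definable_iff, definable_range_iff,
    Equiv.exists_congr_left BoundedFormula.constantsVarsEquiv.symm]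
  refine exists_congr fun φ => iff_of_eq (congrArg (s = ·) ?_)
  ext e
  rw [_root_.Equiv.symm_symm]
  exact (BoundedFormula.realize_constantsVarsEquiv (xs := default)).symm
variable [Nonempty M] {n : ℕ}

theorem isConsistentFormula_completeTheory_iff {φ : L.Formula (Fin n)} :
    (L.completeTheory M).IsConsistentFormula φ ↔ ∃ d : Fin n → M, φ.Realize d := by
  have hψ : ∀ {K : Type (max u v)} [L.Structure K],
      K ⊨ ((φ.relabel Sum.inr : L.Formula (Empty ⊕ Fin n)).iExs (Fin n) : L.Sentence) ↔
        ∃ d : Fin n → K, φ.Realize d := by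
    intro K _
    rw [Sentence.Realize, Formula.realize_iExs]
    simp [Formula.realize_relabel]
  have hψM : M ⊨ ((φ.relabel Sum.inr : L.Formula (Empty ⊕ Fin n)).iExs (Fin n) : L.Sentence) ↔
        ∃ d : Fin n → M, φ.Realize d := by
    rw [Sentence.Realize, Formula.realize_iExs]
    simp [Formula.realize_relabel]
  constructor
  · rintro ⟨N, c, hc⟩
    exact hψM.1 ((realize_iff_of_model_completeTheory M N _).1 (hψ.2 ⟨c, hc⟩))
  · intro h
    obtain ⟨N⟩ : (L.completeTheory M).IsSatisfiable := completeTheory.isSatisfiable L M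
    exact ⟨N, hψ.1 ((realize_iff_of_model_completeTheory M N _).2 (hψM.2 h))⟩

theorem isIsolated_typeOf_iff {d : Fin n → M} :
    ((L.completeTheory M).typeOf d).IsIsolated ↔ L.IsIsolatedOver (∅ : Set M) d := by
  simp only [IsIsolatedOver, empty_definable_iff, Theory.CompleteType.IsIsolated,
    Theory.CompleteType.formula_mem_typeOf]
  constructor
  · rintro ⟨ψ, hψ, h⟩
    refine ⟨_, ⟨ψ, rfl⟩, hψ, ?_⟩
    rintro _ ⟨χ, rfl⟩ hχ e he
    have := h (Theory.typeOf _ e) (Theory.CompleteType.formula_mem_typeOf.2 he)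
    have hχ' := Theory.CompleteType.formula_mem_typeOf (T := L.completeTheory M).2 hχ
    rw [← this] at hχ'
    exact Theory.CompleteType.formula_mem_typeOf.1 hχ'
  · rintro ⟨_, ⟨ψ, rfl⟩, hψ, h⟩
    refine ⟨ψ, hψ, fun q hq => ?_⟩
    -- The type `q` may be realized only outside `M`; each implication from `ψ` is carried to `N` as
    -- a universal sentence.
    obtain ⟨N, e, rfl⟩ := Theory.exists_modelType_is_realized_in _ q
    have he : ψ.Realize e := Theory.CompleteType.formula_mem_typeOf.1 hq
    have key : ∀ χ : L.Formula (Fin n), χ.Realize d → χ.Realize e := by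
      intro χ hχ
      have h1 : M ⊨ (((ψ.imp χ).relabel Sum.inr : L.Formula (Empty ⊕ Fin n)).iAlls (Fin n) :
          L.Sentence) := by
        rw [Sentence.Realize, Formula.realize_iAlls]
        intro y
        rw [Formula.realize_relabel, Sum.elim_comp_inr, Formula.realize_imp]
        exact fun hy => h _ ⟨χ, rfl⟩ hχ hy
      have h2 := (realize_iff_of_model_completeTheory M N _).2 h1
      rw [Sentence.Realize, Formula.realize_iAlls] at h2
      have := h2 e
      rw [Formula.realize_relabel, Sum.elim_comp_inr, Formula.realize_imp] at this
      exact this he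
    refine SetLike.ext fun χ => ?_
    obtain ⟨χ, rfl⟩ := Formula.equivSentence.surjective χ
    rw [Theory.CompleteType.formula_mem_typeOf, Theory.CompleteType.formula_mem_typeOf]
    refine ⟨fun hχ => ?_, key χ⟩
    by_contra hn
    exact key χ.not hn hχ

theorem isIFormula_completeTheory_iff {φ : L.Formula (Fin n)} :
    (L.completeTheory M).IsIFormula φ ↔
      ∃ d : Fin n → M, φ.Realize d ∧ L.IsIsolatedOver (∅ : Set M) d := by
  rw [Theory.IsIFormula, isConsistentFormula_completeTheory_iff]
  constructor
  · rintro ⟨_, p, ⟨ψ, hψp, hψ⟩, hφ⟩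
    obtain ⟨N, e, rfl⟩ := Theory.exists_modelType_is_realized_in _ p
    have he : ψ.Realize e := Theory.CompleteType.formula_mem_typeOf.1 hψp
    have hex : M ⊨ ((ψ.relabel Sum.inr : L.Formula (Empty ⊕ Fin n)).iExs (Fin n) :
        L.Sentence) := by
      rw [← realize_iff_of_model_completeTheory M N, Sentence.Realize, Formula.realize_iExs]
      exact ⟨e, by rwa [Formula.realize_relabel, Sum.elim_comp_inr]⟩
    rw [Sentence.Realize, Formula.realize_iExs] at hex
    obtain ⟨d, hd⟩ := hex
    rw [Formula.realize_relabel, Sum.elim_comp_inr] at hd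
    have hde := hψ (Theory.typeOf _ d) (Theory.CompleteType.formula_mem_typeOf.2 hd)
    rw [← hde] at hφ
    refine ⟨d, Theory.CompleteType.formula_mem_typeOf.1 hφ, isIsolated_typeOf_iff.1 ?_⟩
    rw [hde]
    exact ⟨ψ, hψp, hψ⟩
  · rintro ⟨d, hd, hi⟩
    exact ⟨⟨d, hd⟩, _, isIsolated_typeOf_iff.2 hi, Theory.CompleteType.formula_mem_typeOf.2 hd⟩

theorem allConsistentAreIFormulas_iff {m : ℕ} {b : Fin m → M} :
    L.AllConsistentAreIFormulas b ↔ L.IsolatedDense (range b) := by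
  let _ : (constantsOn (Fin m)).Structure M := constantsOn.structure b
  have hiso : ∀ {n : ℕ} (d : Fin n → M),
      L[[Fin m]].IsIsolatedOver (∅ : Set M) d ↔ L.IsIsolatedOver (range b) d := by
    intro n d
    simp only [IsIsolatedOver, empty_definable_constantsOn_iff (b := b)]
  rw [AllConsistentAreIFormulas, IsolatedDense]
  refine forall_congr' fun n => ?_
  have hcons : ∀ φ : L[[Fin m]].Formula (Fin n), (L.tupleTheory b).IsConsistentFormula φ ↔
      ∃ d : Fin n → M, φ.Realize d := fun φ => isConsistentFormula_completeTheory_iff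
  have hif : ∀ φ : L[[Fin m]].Formula (Fin n), (L.tupleTheory b).IsIFormula φ ↔
      ∃ d : Fin n → M, φ.Realize d ∧ L[[Fin m]].IsIsolatedOver (∅ : Set M) d :=
    fun φ => isIFormula_completeTheory_iff
  simp only [hcons, hif, hiso]
  constructor
  · intro h s hs hne
    obtain ⟨φ, rfl⟩ := empty_definable_iff.1 ((empty_definable_constantsOn_iff (b := b)).2 hs)
    exact h φ hne
  · intro h φ hne
    exact h _ ((empty_definable_constantsOn_iff (b := b)).1 (empty_definable_iff.2 ⟨φ, rfl⟩)) hne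

end CompleteTheory

/-! ### Isolation and density along elementary embeddings -/

section Embedding

variable {L : Language.{u, v}} {M N : Type*} [L.Structure M] [L.Structure N]
variable {α β : Type*}

theorem ElementaryEmbedding.isIsolatedOver_iff [Finite β] (f : N ↪ₑ[L] M) {b : α → N}
    {d : β → N} :
    L.IsIsolatedOver (range (f ∘ b)) (f ∘ d) ↔ L.IsIsolatedOver (range b) d := by
  rw [isIsolatedOver_range_iff, isIsolatedOver_range_iff]
  simp only [← Sum.comp_elim, f.map_formula]
  refine exists_congr fun φ => and_congr_right fun _ => forall_congr' fun χ =>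
    imp_congr_right fun _ => ?_
  have := f.map_formula ((φ.imp χ).iAlls β) b
  simpa only [Formula.realize_iAlls, Formula.realize_imp] using this

theorem ElementaryEmbedding.isolatedDense_range_comp (f : N ↪ₑ[L] M) {b : α → N}
    (h : L.IsolatedDense (range b)) : L.IsolatedDense (range (f ∘ b)) := by
  rintro n s hs ⟨x, hx⟩
  obtain ⟨φ, rfl⟩ := definable_range_iff.1 hs
  have hφ := f.map_formula (φ.iExs (Fin n)) b
  simp only [Formula.realize_iExs] at hφ
  obtain ⟨d, hd, hi⟩ := h n _ (definable_range_iff.2 ⟨φ, rfl⟩) (hφ.1 ⟨x, hx⟩)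
  refine ⟨f ∘ d, ?_, f.isIsolatedOver_iff.2 hi⟩
  rw [mem_ofPred_eq, ← Sum.comp_elim, f.map_formula]
  exact hd

end Embedding

/-! ### Unions of elementary chains -/

section Chain

variable {L : Language.{u, v}} {M : Type w} [L.Structure M] {S : ℕ → L.Substructure M}

theorem IsElementaryChain.monotone (h : IsElementaryChain S) : Monotone S :=
  monotone_nat_of_le_succ h.le_succ

theorem IsElementaryChain.realize_inclusion (h : IsElementaryChain S) {n k : ℕ} (hnk : n ≤ k)
    {l : ℕ} (φ : L.Formula (Fin l)) (x : Fin l → S n) :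
    φ.Realize (Substructure.inclusion (h.monotone hnk) ∘ x) ↔ φ.Realize x := by
  induction k, hnk using Nat.le_induction with
  | base => rfl
  | succ k hnk ih =>
    rw [← ih]
    exact h.elementary k l φ (Substructure.inclusion (h.monotone hnk) ∘ x)

/-- **Tarski's elementary chain theorem**. -/
theorem IsElementaryChain.isElementary (h : IsElementaryChain S) (hS : ∀ x : M, ∃ n, x ∈ S n)
    (n : ℕ) : (S n).IsElementary := by
  -- The index `n` is quantified inside the induction because the quantifier step moves to a later
  -- member containing the new element.
  suffices H : ∀ (l : ℕ) (φ : L.BoundedFormula Empty l) (n : ℕ) (x : Fin l → S n),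
      φ.Realize ((S n).subtype ∘ default) ((S n).subtype ∘ x) ↔ φ.Realize default x by
    intro l φ x
    exact φ.realize_relabel_sumInr.symm.trans ((H l _ n x).trans φ.realize_relabel_sumInr)
  intro l φ
  induction φ with
  | falsum => exact fun _ _ => Iff.rfl
  | equal =>
    intros
    simp [BoundedFormula.Realize, ← Sum.comp_elim]
  | rel R ts =>
    intro n x
    simp only [BoundedFormula.Realize, ← Sum.comp_elim, HomClass.realize_term]
    exact (S n).subtype.map_rel R _
  | imp _ _ ih1 ih2 =>
    intro n x
    rw [BoundedFormula.realize_imp, BoundedFormula.realize_imp, ih1, ih2]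
  | @all l φ ih =>
    intro n x
    simp only [BoundedFormula.realize_all]
    constructor
    · intro H a
      rw [← ih, Fin.comp_snoc]
      exact H a
    · intro H a
      obtain ⟨k, hk⟩ := hS a
      let f : S n ↪ₑ[L] S (max n k) :=
        ⟨Substructure.inclusion (h.monotone (le_max_left n k)),
          fun _ φ x => h.realize_inclusion (le_max_left n k) φ x⟩
      have hf := (f.map_boundedFormula φ.all default x).2 H
      have hf := hf ⟨a, h.monotone (le_max_right n k) hk⟩
      rw [Unique.eq_default (f ∘ default), ← ih, Fin.comp_snoc] at hf
      rw [Unique.eq_default ((S n).subtype ∘ default)]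
      rw [Unique.eq_default ((S (max n k)).subtype ∘ default)] at hf
      exact hf

theorem IsElementaryChain.of_isElementary (hS : ∀ n, (S n).IsElementary)
    (hle : ∀ n, S n ≤ S (n + 1)) : IsElementaryChain S :=
  ⟨hle, fun n _ φ x => (hS (n + 1) φ _).symm.trans (hS n φ x)⟩

end Chain

/-! ### Simultaneous construction of the chain from finite stages -/

section Stages

variable {L : Language.{u, v}} {M : Type w} [L.Structure M]

variable (L M) in
/-- A finite approximation `part 0 ⊆ ⋯ ⊆ part len` to an elementary chain in which the `i`-th
member is atomic over the finite set `base i`. -/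
structure AtomicChainStage where
  /-- The index of the last member of the chain. -/
  len : ℕ
  /-- The set over which the `i`-th member is atomic. -/
  base : ℕ → Finset M
  /-- The part of the `i`-th member that has been constructed. -/
  part : ℕ → Finset M
  dense : ∀ i ≤ len, L.IsolatedDense (base i : Set M)
  isolated : ∀ i ≤ len, L.IsIsolatedOver (base i : Set M) ((↑) : part i → M)
  base_subset : ∀ i ≤ len, base i ⊆ part i
  part_subset : ∀ i < len, part i ⊆ part (i + 1)

namespace AtomicChainStage

instance : Preorder (AtomicChainStage L M) where
  le s t := s.len ≤ t.len ∧ ∀ i ≤ s.len, s.base i = t.base i ∧ s.part i ⊆ t.part i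
  le_refl s := ⟨le_rfl, fun _ _ => ⟨rfl, subset_rfl⟩⟩
  le_trans s t r h h' := ⟨h.1.trans h'.1, fun i hi =>
    ⟨(h.2 i hi).1.trans (h'.2 i (hi.trans h.1)).1,
      (h.2 i hi).2.trans (h'.2 i (hi.trans h.1)).2⟩⟩

theorem base_union_range (s : AtomicChainStage L M) {i : ℕ} (hi : i ≤ s.len) :
    (s.base i : Set M) ∪ range ((↑) : s.part i → M) = s.part i := by
  rw [Subtype.range_coe_subtype, Finset.setOfPred_mem]
  exact union_eq_right.2 (Finset.coe_subset.2 (s.base_subset i hi))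

theorem dense_part (s : AtomicChainStage L M) {i : ℕ} (hi : i ≤ s.len) :
    L.IsolatedDense (s.part i : Set M) := by
  rw [← s.base_union_range hi]
  exact (s.dense i hi).union_range (s.isolated i hi)

/-- The stage with the single member `B`. -/
def single (B : Finset M) (hB : L.IsolatedDense (B : Set M)) : AtomicChainStage L M where
  len := 0
  base _ := B
  part _ := B
  dense _ _ := hB
  isolated _ _ := isIsolatedOver_of_forall_mem fun i => i.2
  base_subset _ _ := subset_rfl
  part_subset _ _ := subset_rfl

theorem exists_append (hM : ∀ A : Finset M, ∃ B : Finset M, A ⊆ B ∧ L.IsolatedDense (B : Set M))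
    (s : AtomicChainStage L M) (A : Finset M) :
    ∃ t, s ≤ t ∧ t.len = s.len + 1 ∧ A ⊆ t.part t.len := by
  classical
  obtain ⟨B, hB, hd⟩ := hM (s.part s.len ∪ A)
  refine ⟨{ len := s.len + 1
            base := Function.update s.base (s.len + 1) B
            part := Function.update s.part (s.len + 1) B
            dense := ?_
            isolated := ?_
            base_subset := ?_
            part_subset := ?_ }, ⟨Nat.le_succ _, fun i hi => ?_⟩, rfl, ?_⟩
  · intro i hi
    obtain rfl | hi := hi.eq_or_lt
    · simpa using hd
    · simpa [hi.ne] using s.dense i (by lia)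
  · intro i hi
    obtain rfl | hi := hi.eq_or_lt
    · rw [Function.update_self, Function.update_self]
      exact isIsolatedOver_of_forall_mem fun i => i.2
    · rw [Function.update_of_ne hi.ne, Function.update_of_ne hi.ne]
      exact s.isolated i (by lia)
  · intro i hi
    obtain rfl | hi := hi.eq_or_lt
    · simp
    · simpa [hi.ne] using s.base_subset i (by lia)
  · intro i hi
    rw [Function.update_of_ne hi.ne]
    obtain rfl | hi := (Nat.lt_succ_iff.1 hi).eq_or_lt
    · rw [Function.update_self]
      exact Finset.union_subset_left hB
    · rw [Function.update_of_ne (by lia)]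
      exact s.part_subset i hi
  · have : i ≠ s.len + 1 := by lia
    simp [this]
  · simpa using Finset.union_subset_right hB

/-- The set is shrunk once for each part, each time into an isolating set. Isolation over an earlier
part holds at every point of the set, so it survives later shrinking. -/
theorem exists_isIsolatedOver_parts (s : AtomicChainStage L M) {i k : ℕ} (hik : i ≤ k)
    (hk : k ≤ s.len) {E : Set (Fin 1 → M)} (hE : (s.part i : Set M).Definable L E)
    (hne : E.Nonempty) :
    ∃ E' ⊆ E, (s.part k : Set M).Definable L E' ∧ E'.Nonempty ∧
      ∀ x ∈ E', ∀ j, i ≤ j → j ≤ k → L.IsIsolatedOver (s.part j : Set M) x := by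
  have step : ∀ {j : ℕ}, j ≤ s.len → ∀ {D : Set (Fin 1 → M)},
      (s.part j : Set M).Definable L D → D.Nonempty → ∃ D' ⊆ D,
        (s.part j : Set M).Definable L D' ∧ D'.Nonempty ∧
          ∀ x ∈ D', L.IsIsolatedOver (s.part j : Set M) x := by
    intro j hj D hD hDne
    obtain ⟨x, hx, r, hr, hxr, hr'⟩ := s.dense_part hj 1 D hD hDne
    exact ⟨r ∩ D, inter_subset_right, hr.inter hD, ⟨x, hxr, hx⟩, fun y hy =>
      ⟨r, hr, hy.1, fun t ht hyt => subset_of_isolates hr' hy.1 ht hyt⟩⟩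
  induction k, hik using Nat.le_induction with
  | base =>
    obtain ⟨D, hDE, hD, hDne, h⟩ := step hk hE hne
    refine ⟨D, hDE, hD, hDne, fun x hx j hj hj' => ?_⟩
    obtain rfl := le_antisymm hj hj'
    exact h x hx
  | succ k hik ih =>
    obtain ⟨E', hE'E, hE', hne', h'⟩ := ih (by lia)
    obtain ⟨D, hDE, hD, hDne, h⟩ := step hk
      (hE'.mono (Finset.coe_subset.2 (s.part_subset k (by lia)))) hne'
    refine ⟨D, hDE.trans hE'E, hD, hDne, fun x hx j hj hj' => ?_⟩
    obtain rfl | hj' := hj'.eq_or_lt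
    · exact h x hx
    · exact h' x (hDE hx) j hj (by lia)

theorem exists_witness (s : AtomicChainStage L M) {i : ℕ} (hi : i ≤ s.len) {E : Set M}
    (hE : (s.part i : Set M).Definable₁ L E) (hne : E.Nonempty) :
    ∃ t, s ≤ t ∧ ∃ x ∈ t.part i, x ∈ E := by
  classical
  obtain ⟨y, hy⟩ := hne
  obtain ⟨E', hE'E, _, ⟨x, hx⟩, h⟩ :=
    s.exists_isIsolatedOver_parts hi le_rfl hE ⟨fun _ => y, hy⟩
  have hsub : ∀ j, s.part j ⊆ if i ≤ j then insert (x 0) (s.part j) else s.part j := by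
    intro j
    split_ifs
    exacts [Finset.subset_insert _ _, subset_rfl]
  refine ⟨{ len := s.len
            base := s.base
            part := fun j => if i ≤ j then insert (x 0) (s.part j) else s.part j
            dense := s.dense
            isolated := ?_
            base_subset := fun j hj => (s.base_subset j hj).trans (hsub j)
            part_subset := ?_ }, ⟨le_rfl, fun j _ => ⟨rfl, hsub j⟩⟩, x 0, ?_, hE'E hx⟩
  · intro j hj
    by_cases hij : i ≤ j
    · rw [if_pos hij]
      have hx' := h x hx j hij hj
      rw [← s.base_union_range hj] at hx'
      -- The old part is isolated over `base j` and `x` over the old part, so together they are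
      -- isolated over `base j`.
      have hsum := (s.isolated j hj).sumElim hx'
      have hmem : ∀ y : ↥(insert (x 0) (s.part j)),
          ∃ z, Sum.elim ((↑) : s.part j → M) x z = (y : M) := by
        rintro ⟨y, hy⟩
        rcases Finset.mem_insert.1 hy with rfl | hy
        · exact ⟨Sum.inr 0, rfl⟩
        · exact ⟨Sum.inl ⟨y, hy⟩, rfl⟩
      choose f hf using hmem
      have hcomp := hsum.comp f
      rwa [show Sum.elim ((↑) : s.part j → M) x ∘ f = ((↑) : ↥(insert (x 0) (s.part j)) → M) from
        funext hf] at hcomp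
    · rw [if_neg hij]
      exact s.isolated j hj
  · intro j hj
    by_cases hij : i ≤ j
    · rw [if_pos hij, if_pos (hij.trans (Nat.le_succ j))]
      exact Finset.insert_subset_insert _ (s.part_subset j hj)
    · rw [if_neg hij]
      exact (s.part_subset j hj).trans (hsub _)
  · simp

theorem exists_le_len (hM : ∀ A : Finset M, ∃ B : Finset M, A ⊆ B ∧ L.IsolatedDense (B : Set M))
    (s : AtomicChainStage L M) (n : ℕ) : ∃ t, s ≤ t ∧ n ≤ t.len := by
  induction n with
  | zero => exact ⟨s, le_rfl, Nat.zero_le _⟩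
  | succ n ih =>
    obtain ⟨t, hst, ht⟩ := ih
    obtain ⟨r, htr, hr, _⟩ := exists_append hM t ∅
    exact ⟨r, hst.trans htr, by lia⟩

/-- A generic sequence of stages: every member gets every witness it needs, and every element of
`M` enters some member. -/
theorem exists_generic_stages [Countable L.Symbols] [Countable M]
    (hM : ∀ A : Finset M, ∃ B : Finset M, A ⊆ B ∧ L.IsolatedDense (B : Set M)) :
    ∃ s : ℕ → AtomicChainStage L M, Monotone s ∧
      (∀ i, ∃ j, i ≤ (s j).len) ∧
      (∀ a, ∃ j, ∃ i ≤ (s j).len, a ∈ (s j).part i) ∧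
      ∀ i j, i ≤ (s j).len → ∀ E : Set M, ((s j).part i : Set M).Definable₁ L E → E.Nonempty →
        ∃ k, i ≤ (s k).len ∧ ∃ x ∈ (s k).part i, x ∈ E := by
  let sols : L.Formula (M ⊕ Fin 1) → Set M := fun φ => {x | φ.Realize (Sum.elim id fun _ => x)}
  let D : M ⊕ (ℕ × L.Formula (M ⊕ Fin 1)) → AtomicChainStage L M → Prop := Sum.elim
    (fun a s => ∃ i ≤ s.len, a ∈ s.part i)
    -- The parameters of the formula may not have entered the part yet, so the requirement speaks of
    -- possible extensions: either one makes the set definable and is then taken and given a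
    -- witness, or none ever will.
    (fun p s => p.1 ≤ s.len ∧
      ((∃ t, s ≤ t ∧ (t.part p.1 : Set M).Definable₁ L (sols p.2)) → (sols p.2).Nonempty →
        ∃ x ∈ s.part p.1, x ∈ sols p.2))
  have hD : ∀ r s, ∃ t, s ≤ t ∧ D r t := by
    rintro (a | ⟨i, φ⟩) s
    · obtain ⟨t, hst, _, ha⟩ := exists_append hM s {a}
      exact ⟨t, hst, t.len, le_rfl, Finset.singleton_subset_iff.1 ha⟩
    · obtain ⟨t, hst, hi⟩ := exists_le_len hM s i
      by_cases h : (∃ r, t ≤ r ∧ (r.part i : Set M).Definable₁ L (sols φ)) ∧ (sols φ).Nonempty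
      · obtain ⟨⟨r, htr, hr⟩, hne⟩ := h
        obtain ⟨q, hrq, hq⟩ := r.exists_witness (hi.trans htr.1) hr hne
        exact ⟨q, (hst.trans htr).trans hrq, (hi.trans htr.1).trans hrq.1, fun _ _ => hq⟩
      · exact ⟨t, hst, hi, fun h1 h2 => absurd ⟨h1, h2⟩ h⟩
  obtain ⟨B, _, hB⟩ := hM ∅
  obtain ⟨s, hs, _, hsD⟩ := exists_generic_seq D hD (single B hB)
  refine ⟨s, hs, fun i => ?_, fun a => hsD (Sum.inl a), fun i j hij E hE hne => ?_⟩
  · obtain ⟨j, hj, _⟩ := hsD (Sum.inr (i, ⊥))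
    exact ⟨j, hj⟩
  · obtain ⟨φ, hφ⟩ := definable_iff_exists_formula_sum.1 hE
    have hEφ : E = sols (φ.relabel (Sum.map (↑) id)) := by
      ext x
      rw [mem_ofPred_eq, Formula.realize_relabel, Sum.elim_comp_map]
      exact Set.ext_iff.1 hφ fun _ => x
    rw [hEφ] at hE hne ⊢
    obtain ⟨k, hk, h⟩ := hsD (Sum.inr (i, φ.relabel (Sum.map (↑) id)))
    -- The parameters may enter after stage `k`; the common later stage shows that the requirement
    -- met at `k` was not vacuous.
    refine ⟨k, hk, h ⟨s (max j k), hs (le_max_right j k), hE.mono ?_⟩ hne⟩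
    exact Finset.coe_subset.2 ((hs (le_max_left j k)).2 i hij).2

end AtomicChainStage

/-- If the finite sets over which isolated types are dense are cofinal among the finite subsets of
a countable structure, then the structure is the union of an elementary chain of substructures that
are prime over finite tuples. -/
theorem exists_isElementaryChain [Countable L.Symbols] [Countable M] [Nonempty M]
    (hM : ∀ A : Finset M, ∃ B : Finset M, A ⊆ B ∧ L.IsolatedDense (B : Set M)) :
    ∃ S : ℕ → L.Substructure M, IsElementaryChain S ∧
      (∀ n, L.IsPrimeOverFinite (S n)) ∧ ∀ x : M, ∃ n, x ∈ S n := by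
  obtain ⟨s, hs, hlen, hmem, hwit⟩ := AtomicChainStage.exists_generic_stages hM
  let U : ℕ → Set M := fun i => {x | ∃ j, i ≤ (s j).len ∧ x ∈ (s j).part i}
  have hpart : ∀ {i j k : ℕ}, i ≤ (s j).len → j ≤ k → (s j).part i ⊆ (s k).part i :=
    fun hi hjk => ((hs hjk).2 _ hi).2
  have hfin : ∀ i (A : Finset M), (A : Set M) ⊆ U i → ∃ j, i ≤ (s j).len ∧ A ⊆ (s j).part i := by
    classical
    intro i A
    induction A using Finset.induction_on with
    | empty => exact fun _ => (hlen i).imp fun j hj => ⟨hj, Finset.empty_subset _⟩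
    | insert a A _ ih =>
      intro hA
      rw [Finset.coe_insert, insert_subset_iff] at hA
      obtain ⟨j, hj, hAj⟩ := ih hA.2
      obtain ⟨k, hk, hak⟩ := hA.1
      refine ⟨max j k, hj.trans (hs (le_max_left j k)).1, Finset.insert_subset ?_ ?_⟩
      · exact hpart hk (le_max_right j k) hak
      · exact hAj.trans (hpart hj (le_max_left j k))
  have hU : ∀ i, L.MeetsDefinable (U i) := by
    intro i E hne hE
    obtain ⟨A, hA, hAE⟩ := definable_iff_finitely_definable.1 hE
    obtain ⟨j, hj, hAj⟩ := hfin i A hA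
    obtain ⟨k, hk, x, hx, hxE⟩ := hwit i j hj E (hAE.mono (Finset.coe_subset.2 hAj)) hne
    exact ⟨x, hxE, k, hk, hx⟩
  let S : ℕ → L.Substructure M := fun i => Substructure.closure L (U i)
  have hSU : ∀ {i x}, x ∈ S i ↔ x ∈ U i := by
    intro i x
    rw [← SetLike.mem_coe, (hU i).closure_eq_self]
  have hSel : ∀ i, (S i).IsElementary := fun i => (hU i).isElementary_closure
  refine ⟨S, IsElementaryChain.of_isElementary hSel fun i => Substructure.closure_mono ?_,
    fun i => ?_, fun x => ?_⟩
  · rintro x ⟨j, hj, hx⟩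
    obtain ⟨k, hk⟩ := hlen (i + 1)
    have hk' : i + 1 ≤ (s (max j k)).len := hk.trans (hs (le_max_right j k)).1
    exact ⟨max j k, hk', (s _).part_subset i hk' (hpart hj (le_max_left j k) hx)⟩
  · obtain ⟨j, hj⟩ := hlen i
    let e := (s j).base i |>.equivFin
    have hbase : ∀ x ∈ (s j).base i, x ∈ S i := fun x hx =>
      hSU.2 ⟨j, hj, (s j).base_subset i hj hx⟩
    let b : Fin ((s j).base i).card → S i := fun l => ⟨e.symm l, hbase _ (e.symm l).2⟩
    let f : S i ↪ₑ[L] M := ⟨(S i).subtype, fun _ φ x => hSel i φ x⟩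
    have hb : range (f ∘ b) = (s j).base i := by
      have : f ∘ b = (↑) ∘ e.symm := rfl
      rw [this, e.symm.surjective.range_comp, Subtype.range_coe_subtype, Finset.setOfPred_mem]
    have : Nonempty (S i) := by
      obtain ⟨x, _, hx⟩ := hU i univ univ_nonempty definable_univ
      exact ⟨⟨x, hSU.2 hx⟩⟩
    refine ⟨_, b, isPrimeOver_of_forall_isIsolatedOver fun n d => ?_⟩
    rw [← f.isIsolatedOver_iff, hb]
    classical
    obtain ⟨k, hk, hdk⟩ := hfin i (Finset.univ.image (f ∘ d)) (by
      rw [Finset.coe_image, Finset.coe_univ, image_univ]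
      rintro _ ⟨l, rfl⟩
      exact hSU.1 (d l).2)
    have hdk : ∀ l, f (d l) ∈ (s k).part i := fun l =>
      hdk (Finset.mem_image_of_mem _ (Finset.mem_univ l))
    -- Bases never change once created, so isolation at the stage that captures `d` is over the base
    -- fixed above.
    have hjk : (s j).base i = (s k).base i := by
      rcases le_total j k with h | h
      · exact ((hs h).2 i hj).1
      · exact ((hs h).2 i hk).1.symm
    rw [hjk]
    exact ((s k).isolated i hk).comp fun l => ⟨f (d l), hdk l⟩
  · obtain ⟨j, i, hij, hx⟩ := hmem x
    exact ⟨i, hSU.2 ⟨j, hij, hx⟩⟩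

end Stages

/-! ### Equivalence with extension of tuples, and the npl-zero criterion -/

section Characterization

variable {L : Language.{u, v}} {M : Type w} [L.Structure M] [Nonempty M]

theorem range_finAppend {α : Type*} {m n : ℕ} (a : Fin m → α) (b : Fin n → α) :
    range (Fin.append a b) = range a ∪ range b := by
  rw [← Sum.elim_range, ← Fin.append_comp_sumElim]
  exact (finSumFinEquiv.surjective.range_comp (Fin.append a b)).symm

/-- Every tuple `(a, d)` is isolated over `b`, hence every `d` is isolated over `b` and `a`
together. -/
theorem IsPrimeOver.isolatedDense_append [Countable L.Symbols] {m n : ℕ} {b : Fin m → M}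
    (hb : L.IsPrimeOver b) (a : Fin n → M) : L.IsolatedDense (range (Fin.append a b)) := by
  have hr : range (Fin.append a b) = range b ∪ range a := by
    rw [range_finAppend, union_comm]
  rw [hr]
  rintro k s - ⟨d, hd⟩
  refine ⟨d, hd, IsIsolatedOver.of_sumElim ?_⟩
  have := (hb.isIsolatedOver (Fin.append a d)).comp (Sum.elim (Fin.castAdd k) (Fin.natAdd n))
  convert! this using 1
  funext i
  rcases i with i | i <;> simp

theorem tuplesExtendToIFormulaTuples_iff :
    L.TuplesExtendToIFormulaTuples M ↔
      ∀ A : Finset M, ∃ B : Finset M, A ⊆ B ∧ L.IsolatedDense (B : Set M) := by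
  classical
  simp only [TuplesExtendToIFormulaTuples, allConsistentAreIFormulas_iff]
  have hr : ∀ {k : ℕ} (c : Fin k → M), ((Finset.univ.image c : Finset M) : Set M) = range c := by
    simp
  constructor
  · intro h A
    obtain ⟨k, c, hc⟩ := h _ ((↑) ∘ A.equivFin.symm : Fin A.card → M)
    refine ⟨Finset.univ.image (Fin.append ((↑) ∘ A.equivFin.symm) c), fun a ha => ?_, ?_⟩
    · refine Finset.mem_image.2 ⟨Fin.castAdd k (A.equivFin ⟨a, ha⟩), Finset.mem_univ _, ?_⟩
      simp
    · rwa [hr]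
  · intro h n a
    obtain ⟨B, hB, hd⟩ := h (Finset.univ.image a)
    refine ⟨_, (↑) ∘ B.equivFin.symm, ?_⟩
    rw [range_finAppend, B.equivFin.symm.surjective.range_comp, Subtype.range_coe_subtype,
      Finset.setOfPred_mem, union_eq_right.2]
    · exact hd
    · rw [← hr]
      exact Finset.coe_subset.2 hB

theorem isPrimeOverFinite_or_isLimitModel_iff [Countable L.Symbols] [Countable M] :
    (L.IsPrimeOverFinite M ∨ L.IsLimitModel M) ↔ L.TuplesExtendToIFormulaTuples M := by
  constructor
  · rintro (⟨m, b, hb⟩ | ⟨_, S, hS, hprime, hU⟩) n a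
    · exact ⟨m, b, allConsistentAreIFormulas_iff.2 (hb.isolatedDense_append a)⟩
    · obtain ⟨N, hN⟩ : ∃ N, ∀ i, a i ∈ S N := by
        choose p hp using fun i => hU (a i)
        exact ⟨Finset.univ.sup p, fun i =>
          hS.monotone (Finset.le_sup (Finset.mem_univ i)) (hp i)⟩
      let f : S N ↪ₑ[L] M := ⟨(S N).subtype, fun _ φ x => hS.isElementary hU N φ x⟩
      have : Nonempty (S N) := by
        obtain ⟨x⟩ := ‹Nonempty M›
        have h1 : ((⊤ : L.Formula (Fin 0 ⊕ Fin 1)).iExs (Fin 1)).Realize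
            (f ∘ (Fin.elim0 : Fin 0 → S N)) :=
          Formula.realize_iExs.2 ⟨fun _ => x, Formula.realize_top.2 trivial⟩
        obtain ⟨y, _⟩ := Formula.realize_iExs.1 ((f.map_formula _ _).1 h1)
        exact ⟨y 0⟩
      obtain ⟨m, b, hb⟩ := hprime N
      refine ⟨m, f ∘ b, allConsistentAreIFormulas_iff.2 ?_⟩
      have := f.isolatedDense_range_comp (hb.isolatedDense_append fun i => (⟨a i, hN i⟩ : S N))
      convert! this using 2
      funext i
      induction i using Fin.addCases with
      | left i => simp only [Fin.append_left, Function.comp_apply]; rfl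
      | right i => simp only [Fin.append_right, Function.comp_apply]
  · intro h
    by_cases hp : L.IsPrimeOverFinite M
    · exact Or.inl hp
    · exact Or.inr ⟨hp, exists_isElementaryChain (tuplesExtendToIFormulaTuples_iff.1 h)⟩

theorem Theory.isNplZero_iff {T : L.Theory} :
    Theory.IsNplZero.{u, v, w} T ↔ ∀ (M : Type w) [L.Structure M] [Nonempty M] [Countable M]
      [M ⊨ T], L.IsPrimeOverFinite M ∨ L.IsLimitModel M := by
  rw [IsNplZero, mk_eq_zero_iff, isEmpty_coe_sort, eq_empty_iff_forall_notMem]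
  constructor
  · intro h M _ _ hM _
    by_contra! hn
    exact h _ ⟨⟨ModelType.of T M, hM⟩, rfl, hn⟩
  · rintro h _ ⟨⟨M, hM⟩, rfl, hn⟩
    exact (not_or.2 hn) (h M)

end Characterization

end FirstOrder.Language

theorem theorem5p2 {L : FirstOrder.Language.{u, v}} (T : L.Theory) (hT : T.IsUnsmall) :
    (∀ (M : Type w) [L.Structure M] [Nonempty M] [Countable M] [M ⊨ T],
      (L.IsPrimeOverFinite M ∨ L.IsLimitModel M) ↔ L.TuplesExtendToIFormulaTuples M) ∧
    (FirstOrder.Language.Theory.IsNplZero.{u, v, w} T ↔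
      ∀ (M : Type w) [L.Structure M] [Nonempty M] [Countable M] [M ⊨ T],
        L.TuplesExtendToIFormulaTuples M) := by
  have := hT.countable
  refine ⟨fun M _ _ _ _ => FirstOrder.Language.isPrimeOverFinite_or_isLimitModel_iff, ?_⟩
  rw [FirstOrder.Language.Theory.isNplZero_iff]
  exact forall_congr' fun M => forall₄_congr fun _ _ _ _ =>
    FirstOrder.Language.isPrimeOverFinite_or_isLimitModel_iff
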